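/- Let $A$ be a unital $C^*$-algebra and $P\subseteq A$ a $C^*$-subalgebra containing the unit of $A$. For a $C^*$-algebra $B$ put $B^\infty=\ell^\infty(\mathbb N,B)/c_0(B)$, where $c_0(B)$ is the ideal of sequences with $\|b_n\|\to0$; $B$ is embedded in $B^\infty$ by constant sequences, $P^\infty\subseteq A^\infty$, and $A_\infty=A^\infty\cap A'$. A conditional expectation $E:A\to P$ is a positive contractive linear map with $E(p)=p$, $E(pa)=pE(a)$ and $E(ap)=E(a)p$ for $p\in P$, $a\in A$; it induces $E^\infty:A^\infty\to P^\infty$ termwise. It has finite index if it has a quasi-basis, that is, a finite family $(u_i,v_i)_{i=1}^n$ in $A\times A$ with $a=\sum_i u_iE(v_ia)=\sum_i E(au_i)v_i$ for all $a\in A$; then its (Watatani) index is $\mathrm{Index}\,E=\sum_i u_iv_i$, which does not depend on the quasi-basis. The inclusion $A\supseteq P$ has the Rohlin property if there are a conditional expectation $E:A\to P$ of finite index and a projection $e\in A_\infty$ such that $E^\infty(e)=(\mathrm{Index}\,E)^{-1}\cdot 1$ and the map $A\ni x\mapsto xe\in A^\infty$ is injective. A unital $C^*$-algebra has real rank zero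 if its invertible self-adjoint elements are dense in its self-adjoint elements. Theorem. If the inclusion $A\supseteq P$ has the Rohlin property and $A$ has real rank zero, then $P$ has real rank zero. -/

import Mathlib

open Filter Topology
open scoped BoundedContinuousFunction

namespace RohlinInclusion

section SequenceAlgebra

/-- The two-sided ideal `c₀(A)` of sequences tending to `0` in `ℓ^∞(ℕ, A)`. Bounded sequences in `A`
are the bounded (automatically continuous) functions on the discrete space `ℕ`, with the sup norm
and the pointwise operations. -/
def c0 (A : Type*) [CStarAlgebra A] : Ideal (ℕ →ᵇ A) where
  carrier := {a | Tendsto (fun n => ‖a n‖) atTop (𝓝 0)}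
  zero_mem' := by simp
  add_mem' := by
    intro a b ha hb
    have ha' := tendsto_zero_iff_norm_tendsto_zero.2 ha
    have hb' := tendsto_zero_iff_norm_tendsto_zero.2 hb
    refine tendsto_zero_iff_norm_tendsto_zero.1 ?_
    have h := ha'.add hb'
    rw [add_zero] at h
    exact h
  smul_mem' := by
    intro c a ha
    refine squeeze_zero (fun n => norm_nonneg _) (g := fun n => ‖c‖ * ‖a n‖) (fun n => ?_) ?_
    · simpa using (norm_mul_le (c n) (a n)).trans
        (mul_le_mul_of_nonneg_right (c.norm_coe_le_norm n) (norm_nonneg _))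
    · simpa using Tendsto.const_mul ‖c‖ ha

theorem mem_c0 {A : Type*} [CStarAlgebra A] {a : ℕ →ᵇ A} :
    a ∈ c0 A ↔ Tendsto (fun n => ‖a n‖) atTop (𝓝 0) := Iff.rfl

instance c0_isTwoSided (A : Type*) [CStarAlgebra A] : (c0 A).IsTwoSided where
  mul_mem_of_left := by
    intro a c ha
    refine squeeze_zero (fun n => norm_nonneg _) (g := fun n => ‖a n‖ * ‖c‖) (fun n => ?_) ?_
    · simpa using (norm_mul_le (a n) (c n)).trans
        (mul_le_mul_of_nonneg_left (c.norm_coe_le_norm n) (norm_nonneg _))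
    · simpa using Tendsto.mul_const ‖c‖ ha

/-- The sequence algebra `A^∞ = ℓ^∞(ℕ, A) / c₀(A)`. -/
abbrev SeqAlgebra (A : Type*) [CStarAlgebra A] : Type _ := (ℕ →ᵇ A) ⧸ c0 A

/-- The class in `A^∞` of a bounded sequence, as a homomorphism of complex algebras. -/
noncomputable def toSeq (A : Type*) [CStarAlgebra A] : (ℕ →ᵇ A) →ₐ[ℂ] SeqAlgebra A :=
  Ideal.Quotient.mkₐ ℂ (c0 A)

theorem toSeq_surjective (A : Type*) [CStarAlgebra A] : Function.Surjective (toSeq A) :=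
  Ideal.Quotient.mk_surjective

theorem toSeq_eq_iff {A : Type*} [CStarAlgebra A] {a b : ℕ →ᵇ A} :
    toSeq A a = toSeq A b ↔ a - b ∈ c0 A := Ideal.Quotient.eq

/-- The involution of `A^∞`, induced by the pointwise involution of sequences. -/
noncomputable instance seqStar (A : Type*) [CStarAlgebra A] : Star (SeqAlgebra A) where
  star := Quotient.lift (fun a : ℕ →ᵇ A => toSeq A (star a)) (by
    intro a b h
    have h' : a - b ∈ c0 A := toSeq_eq_iff.1 (Quotient.sound h)
    refine toSeq_eq_iff.2 ?_
    rw [← star_sub]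
    simpa [mem_c0, ← star_sub] using h')

theorem star_toSeq {A : Type*} [CStarAlgebra A] (a : ℕ →ᵇ A) :
    star (toSeq A a) = toSeq A (star a) := rfl

noncomputable instance seqStarRing (A : Type*) [CStarAlgebra A] : StarRing (SeqAlgebra A) where
  star_involutive x := by
    obtain ⟨a, rfl⟩ := toSeq_surjective A x
    simp [star_toSeq]
  star_mul x y := by
    obtain ⟨a, rfl⟩ := toSeq_surjective A x
    obtain ⟨b, rfl⟩ := toSeq_surjective A y
    rw [← map_mul, star_toSeq, star_toSeq, star_toSeq, star_mul, map_mul]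
  star_add x y := by
    obtain ⟨a, rfl⟩ := toSeq_surjective A x
    obtain ⟨b, rfl⟩ := toSeq_surjective A y
    rw [← map_add, star_toSeq, star_toSeq, star_toSeq, star_add, map_add]

instance seqStarModule (A : Type*) [CStarAlgebra A] : StarModule ℂ (SeqAlgebra A) where
  star_smul c x := by
    obtain ⟨a, rfl⟩ := toSeq_surjective A x
    rw [← map_smul, star_toSeq, star_toSeq, star_smul, map_smul]

/-- The embedding of `A` in `A^∞` by (classes of) constant sequences. -/
noncomputable def constSeq (A : Type*) [CStarAlgebra A] : A →⋆ₐ[ℂ] SeqAlgebra A where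
  toFun a := toSeq A (BoundedContinuousFunction.const ℕ a)
  map_one' := map_one (toSeq A)
  map_mul' a b := map_mul (toSeq A) (BoundedContinuousFunction.const ℕ a)
    (BoundedContinuousFunction.const ℕ b)
  map_zero' := map_zero (toSeq A)
  map_add' a b := map_add (toSeq A) (BoundedContinuousFunction.const ℕ a)
    (BoundedContinuousFunction.const ℕ b)
  commutes' c := (toSeq A).commutes c
  map_star' _ := rfl

/-- The central sequence algebra `A_∞ = A^∞ ∩ A'`. -/
noncomputable def centralSeqAlgebra (A : Type*) [CStarAlgebra A] : StarSubalgebra ℂ (SeqAlgebra A) :=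
  StarSubalgebra.centralizer ℂ (Set.range (constSeq A))

/-- The linear map `A^∞ → B^∞` induced termwise by a bounded linear map `A → B`. -/
noncomputable def seqMap {A B : Type*} [CStarAlgebra A] [CStarAlgebra B] (f : A →L[ℂ] B) :
    SeqAlgebra A →ₗ[ℂ] SeqAlgebra B where
  toFun := Quotient.lift (fun a : ℕ →ᵇ A => toSeq B (f.compLeftContinuousBounded ℕ a)) (by
    intro a b h
    have h' : a - b ∈ c0 A := toSeq_eq_iff.1 (Quotient.sound h)
    refine toSeq_eq_iff.2 ?_
    rw [← map_sub]
    refine squeeze_zero (fun n => norm_nonneg _) (g := fun n => ‖f‖ * ‖(a - b) n‖)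
      (fun n => f.le_opNorm _) ?_
    simpa using Tendsto.const_mul ‖f‖ h')
  map_add' x y := by
    obtain ⟨a, rfl⟩ := toSeq_surjective A x
    obtain ⟨b, rfl⟩ := toSeq_surjective A y
    rw [← map_add]
    exact (congrArg (toSeq B) (map_add (f.compLeftContinuousBounded ℕ) a b)).trans (map_add _ _ _)
  map_smul' c x := by
    obtain ⟨a, rfl⟩ := toSeq_surjective A x
    rw [← map_smul]
    exact (congrArg (toSeq B) (map_smul (f.compLeftContinuousBounded ℕ) c a)).trans
      (map_smul _ _ _)

theorem seqMap_toSeq {A B : Type*} [CStarAlgebra A] [CStarAlgebra B] (f : A →L[ℂ] B)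
    (a : ℕ →ᵇ A) : seqMap f (toSeq A a) = toSeq B (f.compLeftContinuousBounded ℕ a) := rfl

end SequenceAlgebra

section ConditionalExpectation

/-- A conditional expectation from `A` onto the unital C*-subalgebra `P`: a positive contractive
`P`-bimodule projection of `A` onto `P`. -/
structure ConditionalExpectation {A : Type*} [CStarAlgebra A] (P : StarSubalgebra ℂ A) where
  /-- The underlying bounded linear map. -/
  toMap : A →L[ℂ] P
  norm_le : ∀ a : A, ‖toMap a‖ ≤ ‖a‖
  positive : ∀ a : A, ∃ c : P, toMap (star a * a) = star c * c
  proj : ∀ p : P, toMap (p : A) = p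
  left_mod : ∀ (p : P) (a : A), toMap ((p : A) * a) = p * toMap a
  right_mod : ∀ (a : A) (p : P), toMap (a * (p : A)) = toMap a * p

variable {A : Type*} [CStarAlgebra A] {P : StarSubalgebra ℂ A}

/-- The finite family `(u i, v i)` is a quasi-basis for `E`. -/
def IsQuasiBasis (E : ConditionalExpectation P) {n : ℕ} (u v : Fin n → A) : Prop :=
  ∀ a : A, a = ∑ i, u i * (E.toMap (v i * a) : A) ∧ a = ∑ i, (E.toMap (a * u i) : A) * v i

/-- `E` has finite (Watatani) index: it has a quasi-basis. -/
def HasFiniteIndex (E : ConditionalExpectation P) : Prop :=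
  ∃ (n : ℕ) (u v : Fin n → A), IsQuasiBasis E u v

open Classical in
/-- The Watatani index `∑ i, u i * v i` of a conditional expectation `E` of finite index, computed
with any quasi-basis (see `watataniIndex_eq`). -/
noncomputable def watataniIndex (E : ConditionalExpectation P) : A :=
  if h : HasFiniteIndex E then
    ∑ i, h.choose_spec.choose i * h.choose_spec.choose_spec.choose i
  else 0

theorem IsQuasiBasis.sum_eq {E : ConditionalExpectation P} {m n : ℕ} {u v : Fin m → A}
    {u' v' : Fin n → A} (h : IsQuasiBasis E u v) (h' : IsQuasiBasis E u' v') :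
    ∑ i, u i * v i = ∑ j, u' j * v' j := by
  calc ∑ i, u i * v i
      = ∑ i, u i * ∑ j, (E.toMap (v i * u' j) : A) * v' j :=
        Finset.sum_congr rfl fun i _ => by rw [← (h' (v i)).2]
    _ = ∑ j, (∑ i, u i * (E.toMap (v i * u' j) : A)) * v' j := by
        simp only [Finset.mul_sum, Finset.sum_mul, mul_assoc]
        exact Finset.sum_comm
    _ = ∑ j, u' j * v' j := Finset.sum_congr rfl fun j _ => by rw [← (h (u' j)).1]

theorem watataniIndex_eq {E : ConditionalExpectation P} {n : ℕ} {u v : Fin n → A}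
    (h : IsQuasiBasis E u v) : watataniIndex E = ∑ i, u i * v i := by
  have hE : HasFiniteIndex E := ⟨n, u, v, h⟩
  rw [watataniIndex, dif_pos hE]
  exact hE.choose_spec.choose_spec.choose_spec.sum_eq h

/-- The inclusion of `P` in `A` as a bounded linear map. -/
noncomputable def inclusionMap (P : StarSubalgebra ℂ A) : P →L[ℂ] A :=
  P.subtype.toAlgHom.toLinearMap.mkContinuous 1 (fun p => by simp)

/-- The conditional expectation `E` has the Rohlin property: it has finite index and there is a
projection `e ∈ A_∞` with `E^∞(e) = (Index E)⁻¹ · 1`, an equation in `A^∞ ⊇ P^∞`, such that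
`x ↦ x e` is injective on `A`. -/
def HasRohlinProperty [IsClosed (P : Set A)] (E : ConditionalExpectation P) : Prop :=
  HasFiniteIndex E ∧
  ∃ e ∈ centralSeqAlgebra A, IsStarProjection e ∧
    (∃ w : Aˣ, (w : A) = watataniIndex E ∧
      seqMap (inclusionMap P) (seqMap E.toMap e) = constSeq A ((w⁻¹ : Aˣ) : A)) ∧
    Function.Injective (fun x : A => constSeq A x * e)

/-- `A ⊇ P` is an inclusion with the Rohlin property: some conditional expectation of `A` onto `P`
has the Rohlin property. -/
def InclusionHasRohlinProperty (P : StarSubalgebra ℂ A) [IsClosed (P : Set A)] : Prop :=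
  ∃ E : ConditionalExpectation P, HasRohlinProperty E

end ConditionalExpectation

/-- A unital C*-algebra has real rank zero if its invertible self-adjoint elements are dense in its
self-adjoint elements. -/
def RealRankZero (A : Type*) [CStarAlgebra A] : Prop :=
  Dense {x : selfAdjoint A | IsUnit (x : A)}

end RohlinInclusion

namespace RohlinInclusion

/-! ### Positivity of matrices over a C*-algebra. -/

section Positivity

/-! With `w` the index and `e` the Rohlin projection, `β x = w * E^∞(e * x)` is a *-homomorphism
from `A` to `P^∞` that fixes `P`. Real rank zero then descends: approximate `p` in `P` by an
invertible self-adjoint `x` in `A`; far out, the terms of a sequence in `P` representing `β x` are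
invertible and close to `p`.

Multiplicativity rests on `e * z = w * e * E^∞(e * z)`
(`IsQuasiBasis.mul_eq_index_mul_mul_seqExpectation`), which gives `e * x = e * β x`. To prove it,
let `T z` be the difference of the two sides. `T` is right linear over the range of `E^∞`, so its
values on the quasi-basis decide it. Factoring the Gram matrix `E(v i * star (v j))` as `H * star H`
turns `∑ j, T(star (v j)) * star (T (u j))` into a sum of terms `y * star y`; direct expansion shows
that this sum is zero, so every `y`, and with them `T`, vanishes. -/

theorem eq_zero_of_sum_star_mul_self_eq_zero {B : Type*} [CStarAlgebra B] {ι : Type*} [Fintype ι]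
    {x : ι → B} (h : ∑ i, star (x i) * x i = 0) (i : ι) : x i = 0 := by
  let _ := CStarAlgebra.spectralOrder B
  have _ := CStarAlgebra.spectralOrderedRing B
  have h0 := (Finset.sum_eq_zero_iff_of_nonneg fun j _ => star_mul_self_nonneg (x j)).1 h i
    (Finset.mem_univ i)
  exact CStarRing.star_mul_self_eq_zero_iff _ |>.1 h0

/-- With `N` the negative part of `M`, the compression `N * M * N = -N ^ 3` detects positivity. -/
theorem _root_.IsSelfAdjoint.exists_conjugate_eq_neg_star_mul_self {C : Type*} [CStarAlgebra C]
    {M : C} (hM : IsSelfAdjoint M) :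
    ∃ N K : C, IsSelfAdjoint N ∧ N * M * N = -(star K * K) ∧
      (K = 0 → ∃ L, M = star L * L) := by
  let _ := CStarAlgebra.spectralOrder C
  have _ := CStarAlgebra.spectralOrderedRing C
  have hN : 0 ≤ M⁻ := CFC.negPart_nonneg M
  have hNs : star M⁻ = M⁻ := (IsSelfAdjoint.of_nonneg hN).star_eq
  have hcube : 0 ≤ M⁻ * M⁻ * M⁻ := by
    have := star_left_conjugate_nonneg hN M⁻
    rwa [hNs] at this
  obtain ⟨K, hK⟩ := CStarAlgebra.nonneg_iff_eq_star_mul_self.1 hcube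
  refine ⟨M⁻, K, hNs, ?_, fun hK0 => ?_⟩
  · rw [← hK]
    calc M⁻ * M * M⁻ = M⁻ * (M⁺ - M⁻) * M⁻ := by rw [CFC.posPart_sub_negPart M hM]
      _ = -(M⁻ * M⁻ * M⁻) := by simp [mul_sub]
  have hN0 : M⁻ = 0 := by
    have h3 : M⁻ * M⁻ * M⁻ = 0 := by rw [hK, hK0, mul_zero]
    -- The C*-identity takes the fourth power of `M⁻` down to its square, and then the square to
    -- `M⁻`.
    have h4 : star (M⁻ * M⁻) * (M⁻ * M⁻) = 0 := by
      rw [star_mul, hNs, ← mul_assoc, h3, zero_mul]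
    have h2 := (CStarRing.star_mul_self_eq_zero_iff _).1 h4
    refine (CStarRing.star_mul_self_eq_zero_iff _).1 ?_
    rw [hNs, h2]
  have hM0 : 0 ≤ M := by
    rw [← CFC.posPart_sub_negPart M hM, hN0, sub_zero]
    exact CFC.posPart_nonneg M
  exact CStarAlgebra.nonneg_iff_eq_star_mul_self.1 hM0

/-- A self-adjoint matrix over a C*-algebra whose quadratic form takes positive values has the form
`H * star H`. -/
theorem exists_eq_sum_mul_star {B : Type*} [CStarAlgebra B] {n : ℕ} (G : Fin n → Fin n → B)
    (hG : ∀ i j, star (G i j) = G j i)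
    (hpos : ∀ p : Fin n → B, ∃ c : B, ∑ i, ∑ j, p i * G i j * star (p j) = star c * c) :
    ∃ H : Fin n → Fin n → B, ∀ i j, G i j = ∑ k, H i k * star (H j k) := by
  let _ := CStarAlgebra.spectralOrder B
  have _ := CStarAlgebra.spectralOrderedRing B
  let M : CStarMatrix (Fin n) (Fin n) B := CStarMatrix.ofMatrix G
  have hM : IsSelfAdjoint M := by
    ext i j
    exact hG j i
  obtain ⟨N, K, hN, hNMN, hK⟩ := hM.exists_conjugate_eq_neg_star_mul_self
  obtain ⟨L, hL⟩ := hK <| by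
    ext l k
    -- Testing the form on row `k` of `N` makes the diagonal entry of `N * M * N` positive, while it
    -- is also minus a sum of squares from column `k` of `K`.
    obtain ⟨c, hc⟩ := hpos (fun i => N k i)
    have hentry : (N * M * N) k k = star c * c := by
      rw [← hc, CStarMatrix.mul_apply, Finset.sum_comm]
      refine Finset.sum_congr rfl fun j _ => ?_
      rw [CStarMatrix.mul_apply, Finset.sum_mul]
      refine Finset.sum_congr rfl fun i _ => ?_
      rw [← CStarMatrix.star_apply, hN.star_eq]
      rfl
    rw [hNMN, CStarMatrix.neg_apply, CStarMatrix.mul_apply] at hentry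
    -- `none` indexes the extra square of `c`.
    have hsum : ∑ o : Option (Fin n), star (o.elim c (fun l => K l k)) * (o.elim c fun l => K l k)
        = 0 := by
      rw [Fintype.sum_option]
      simp only [Option.elim, ← hentry, CStarMatrix.star_apply]
      exact neg_add_cancel _
    exact eq_zero_of_sum_star_mul_self_eq_zero hsum (some l)
  refine ⟨fun i k => star (L k i), fun i j => ?_⟩
  change M i j = _
  rw [hL, CStarMatrix.mul_apply]
  simp [CStarMatrix.star_apply]

end Positivity

/-! ### Conditional expectations, quasi-bases and their extension to sequences. -/

section Expectation

variable {A : Type*} [CStarAlgebra A] {P : StarSubalgebra ℂ A}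

/-- Positivity speaks only of squares, so `4b` is written as `(b + 1)² - (b - 1)²`. -/
theorem ConditionalExpectation.map_isSelfAdjoint (E : ConditionalExpectation P) {b : A}
    (hb : IsSelfAdjoint b) : IsSelfAdjoint (E.toMap b) := by
  have hsq (c : A) (hc : IsSelfAdjoint c) : IsSelfAdjoint (E.toMap (c * c)) := by
    obtain ⟨d, hd⟩ := E.positive c
    rw [hc.star_eq] at hd
    rw [hd]
    exact IsSelfAdjoint.star_mul_self d
  have h := (hsq _ (hb.add (.one A))).sub (hsq _ (hb.sub (.one A)))
  rw [← map_sub] at h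
  have h4 : (b + 1) * (b + 1) - (b - 1) * (b - 1) = (4 : ℝ) • b := by
    rw [show (4 : ℝ) • b = (4 : ℕ) • b by rw [← Nat.cast_smul_eq_nsmul ℝ]; norm_num]
    noncomm_ring
  rw [h4] at h
  have := (IsSelfAdjoint.all (1 / 4 : ℝ)).smul h
  rw [show E.toMap ((4 : ℝ) • b) = (4 : ℝ) • E.toMap b from
    E.toMap.toLinearMap.map_smul_of_tower (4 : ℝ) b, smul_smul] at this
  simpa using this

theorem ConditionalExpectation.map_star (E : ConditionalExpectation P) (a : A) :
    E.toMap (star a) = star (E.toMap a) := by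
  conv_lhs => rw [← realPart_add_I_smul_imaginaryPart a]
  conv_rhs => rw [← realPart_add_I_smul_imaginaryPart a]
  simp only [star_add, star_smul, map_add, map_smul,
    (E.map_isSelfAdjoint (realPart a).2).star_eq, (realPart a).2.star_eq,
    (E.map_isSelfAdjoint (imaginaryPart a).2).star_eq, (imaginaryPart a).2.star_eq]

theorem IsQuasiBasis.conj {E : ConditionalExpectation P} {n : ℕ} {u v : Fin n → A}
    (h : IsQuasiBasis E u v) : IsQuasiBasis E (fun i => star (v i)) (fun i => star (u i)) := by
  refine fun a => ⟨?_, ?_⟩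
  · have := congrArg star (h (star a)).2
    simpa [star_sum, star_mul, ← StarMemClass.coe_star, ← E.map_star] using this
  · have := congrArg star (h (star a)).1
    simpa [star_sum, star_mul, ← StarMemClass.coe_star, ← E.map_star] using this

theorem IsQuasiBasis.isSelfAdjoint_sum {E : ConditionalExpectation P} {n : ℕ} {u v : Fin n → A}
    (h : IsQuasiBasis E u v) : IsSelfAdjoint (∑ i, u i * v i) := by
  rw [isSelfAdjoint_iff]
  simpa only [star_sum, star_mul] using h.conj.sum_eq h

/-- Expanding `v i * a` by one half of the quasi-basis identity and resumming by the other moves `a`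
across. -/
theorem IsQuasiBasis.commute_sum {E : ConditionalExpectation P} {n : ℕ} {u v : Fin n → A}
    (h : IsQuasiBasis E u v) (a : A) : Commute (∑ i, u i * v i) a := by
  calc (∑ i, u i * v i) * a
      = ∑ i, u i * ∑ j, (E.toMap (v i * a * u j) : A) * v j := by
        rw [Finset.sum_mul]
        exact Finset.sum_congr rfl fun i _ => by rw [← (h (v i * a)).2, mul_assoc]
    _ = ∑ j, (∑ i, u i * (E.toMap (v i * (a * u j)) : A)) * v j := by
        simp only [Finset.mul_sum, Finset.sum_mul, mul_assoc]
        exact Finset.sum_comm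
    _ = a * ∑ j, u j * v j := by
        rw [Finset.mul_sum]
        exact Finset.sum_congr rfl fun j _ => by rw [← (h (a * u j)).1, mul_assoc]

/-- This is the complete positivity of `E`: by the bimodule property, the quadratic form at `p` is
`E` of the square built from `∑ i, p i * v i`. -/
theorem ConditionalExpectation.exists_gram_factorization [IsClosed (P : Set A)]
    (E : ConditionalExpectation P) {n : ℕ} (v : Fin n → A) :
    ∃ H : Fin n → Fin n → P, ∀ i j, E.toMap (v i * star (v j)) = ∑ k, H i k * star (H j k) := by
  refine exists_eq_sum_mul_star _ (fun i j => ?_) fun p => ?_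
  · rw [← E.map_star, star_mul, star_star]
  · obtain ⟨c, hc⟩ := E.positive (star (∑ i, (p i : A) * v i))
    refine ⟨c, hc ▸ ?_⟩
    simp only [star_star, star_sum, star_mul, Finset.sum_mul_sum, map_sum]
    refine Finset.sum_congr rfl fun i _ => Finset.sum_congr rfl fun j _ => ?_
    rw [← E.left_mod, ← E.right_mod]
    simp [mul_assoc]

variable [IsClosed (P : Set A)]

/-- `E^∞` viewed as a map of `A^∞` into itself. -/
noncomputable def seqExpectation (E : ConditionalExpectation P) :
    SeqAlgebra A →ₗ[ℂ] SeqAlgebra A :=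
  seqMap (inclusionMap P) ∘ₗ seqMap E.toMap

theorem seqExpectation_toSeq (E : ConditionalExpectation P) (a : ℕ →ᵇ A) :
    seqExpectation E (toSeq A a) =
      toSeq A (((inclusionMap P).comp E.toMap).compLeftContinuousBounded ℕ a) := rfl

theorem seqExpectation_constSeq (E : ConditionalExpectation P) (a : A) :
    seqExpectation E (constSeq A a) = constSeq A (E.toMap a : A) := rfl

theorem seqExpectation_left_mod (E : ConditionalExpectation P) (x y : SeqAlgebra A) :
    seqExpectation E (seqExpectation E x * y) = seqExpectation E x * seqExpectation E y := by
  obtain ⟨a, rfl⟩ := toSeq_surjective A x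
  obtain ⟨b, rfl⟩ := toSeq_surjective A y
  simp only [seqExpectation_toSeq, ← map_mul]
  congr 1
  ext n
  exact congrArg Subtype.val (E.left_mod (E.toMap (a n)) (b n))

theorem seqExpectation_right_mod (E : ConditionalExpectation P) (x y : SeqAlgebra A) :
    seqExpectation E (x * seqExpectation E y) = seqExpectation E x * seqExpectation E y := by
  obtain ⟨a, rfl⟩ := toSeq_surjective A x
  obtain ⟨b, rfl⟩ := toSeq_surjective A y
  simp only [seqExpectation_toSeq, ← map_mul]
  congr 1
  ext n
  exact congrArg Subtype.val (E.right_mod (a n) (E.toMap (b n)))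

theorem star_seqExpectation (E : ConditionalExpectation P) (x : SeqAlgebra A) :
    star (seqExpectation E x) = seqExpectation E (star x) := by
  obtain ⟨a, rfl⟩ := toSeq_surjective A x
  simp only [seqExpectation_toSeq, star_toSeq]
  congr 1
  ext n
  exact congrArg Subtype.val (E.map_star (a n)).symm

theorem seqExpectation_coe (E : ConditionalExpectation P) (p : P) :
    seqExpectation E (constSeq A p) = constSeq A p := by
  rw [seqExpectation_constSeq, E.proj]

theorem IsQuasiBasis.eq_sum_seq {E : ConditionalExpectation P} {n : ℕ} {u v : Fin n → A}
    (h : IsQuasiBasis E u v) (z : SeqAlgebra A) :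
    z = ∑ i, constSeq A (u i) * seqExpectation E (constSeq A (v i) * z) := by
  obtain ⟨a, rfl⟩ := toSeq_surjective A z
  have (i : Fin n) : constSeq A (u i) * seqExpectation E (constSeq A (v i) * toSeq A a) =
      toSeq A (.const ℕ (u i) * (((inclusionMap P).comp E.toMap).compLeftContinuousBounded ℕ
        (.const ℕ (v i) * a))) := rfl
  simp only [this, ← map_sum]
  congr 1
  ext m
  rw [BoundedContinuousFunction.sum_apply]
  exact (h (a m)).1

theorem IsQuasiBasis.eq_sum_seq' {E : ConditionalExpectation P} {n : ℕ} {u v : Fin n → A}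
    (h : IsQuasiBasis E u v) (z : SeqAlgebra A) :
    z = ∑ i, seqExpectation E (z * constSeq A (u i)) * constSeq A (v i) := by
  obtain ⟨a, rfl⟩ := toSeq_surjective A z
  have (i : Fin n) : seqExpectation E (toSeq A a * constSeq A (u i)) * constSeq A (v i) =
      toSeq A ((((inclusionMap P).comp E.toMap).compLeftContinuousBounded ℕ
        (a * .const ℕ (u i))) * .const ℕ (v i)) := rfl
  simp only [this, ← map_sum]
  congr 1
  ext m
  rw [BoundedContinuousFunction.sum_apply]
  exact (h (a m)).2

theorem constSeq_star (a : A) : constSeq A (Star.star a) = Star.star (constSeq A a) := rfl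

theorem commute_constSeq {w : A} (hw : ∀ a, Commute w a) (z : SeqAlgebra A) :
    Commute (constSeq A w) z := by
  obtain ⟨a, rfl⟩ := toSeq_surjective A z
  change toSeq A (.const ℕ w * a) = toSeq A (a * .const ℕ w)
  congr 1
  ext m
  exact hw (a m)

/-- Termwise in `A`, each summand is dominated by the whole sum, so its norm tends to zero with that
of the sum. -/
theorem SeqAlgebra.eq_zero_of_sum_mul_star_self_eq_zero {ι : Type*} [Fintype ι]
    {x : ι → SeqAlgebra A} (h : ∑ i, x i * star (x i) = 0) (i : ι) : x i = 0 := by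
  choose a ha using fun i => toSeq_surjective A (x i)
  have hsum : ∑ i, x i * star (x i) = toSeq A (∑ i, a i * star (a i)) := by
    simp only [map_sum, map_mul, ← star_toSeq, ha]
  rw [hsum, ← map_zero (toSeq A), toSeq_eq_iff, sub_zero, mem_c0] at h
  rw [← ha, ← map_zero (toSeq A), toSeq_eq_iff, sub_zero, mem_c0]
  have hle (m : ℕ) : ‖a i m‖ ≤ √‖(∑ i, a i * star (a i)) m‖ := by
    let _ := CStarAlgebra.spectralOrder A
    have _ := CStarAlgebra.spectralOrderedRing A
    refine Real.le_sqrt_of_sq_le ?_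
    rw [sq, ← CStarRing.norm_self_mul_star, BoundedContinuousFunction.sum_apply]
    exact CStarAlgebra.norm_le_norm_of_nonneg_of_le (mul_star_self_nonneg _)
      (Finset.single_le_sum (f := fun j => a j m * star (a j m))
        (fun j _ => mul_star_self_nonneg (a j m)) (Finset.mem_univ i))
  refine squeeze_zero (fun _ => norm_nonneg _) hle ?_
  simpa [Function.comp_def] using (Real.continuous_sqrt.tendsto 0).comp h

end Expectation

/-! ### The compression identity for a Rohlin projection. -/

section RohlinProjection

variable {A : Type*} [CStarAlgebra A] {P : StarSubalgebra ℂ A} [IsClosed (P : Set A)]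

/-- If a projection `e` commuting with `A` satisfies `E^∞(e) = (Index E)⁻¹`, then the compression of
the Jones projection by `e` is `(Index E)⁻¹ e`. -/
theorem IsQuasiBasis.mul_eq_index_mul_mul_seqExpectation {E : ConditionalExpectation P} {n : ℕ}
    {u v : Fin n → A} (h : IsQuasiBasis E u v) {e : SeqAlgebra A} (he : e ∈ centralSeqAlgebra A)
    (hproj : IsStarProjection e) {w w' : A} (hw : w = ∑ i, u i * v i) (hww' : w * w' = 1)
    (hE : seqExpectation E e = constSeq A w') (z : SeqAlgebra A) :
    e * z = constSeq A w * e * seqExpectation E (e * z) := by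
  have hee : e * e = e := hproj.isIdempotentElem.eq
  have hes : star e = e := hproj.isSelfAdjoint.star_eq
  set W := constSeq A w with hWdef
  have hWz (z : SeqAlgebra A) : W * z = z * W :=
    commute_constSeq (fun a => hw ▸ h.commute_sum a) z
  have hWW' : W * constSeq A w' = 1 := by rw [← map_mul, hww', map_one]
  have hec (a : A) : e * constSeq A a = constSeq A a * e :=
    ((StarSubalgebra.mem_centralizer_iff ℂ).1 he _ ⟨a, rfl⟩).1.symm
  have hsw : star W = W := by
    rw [hWdef, ← constSeq_star, hw, h.isSelfAdjoint_sum.star_eq]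
  set F := seqExpectation E
  let T : SeqAlgebra A →ₗ[ℂ] SeqAlgebra A :=
    LinearMap.mulLeft ℂ e - LinearMap.mulLeft ℂ (W * e) ∘ₗ F ∘ₗ LinearMap.mulLeft ℂ e
  have hT (z : SeqAlgebra A) : T z = e * z - W * e * F (e * z) := rfl
  have hTF (x y : SeqAlgebra A) : T (x * F y) = T x * F y := by
    rw [hT, hT, ← mul_assoc, seqExpectation_right_mod, sub_mul, mul_assoc (W * e)]
  -- The conjugate quasi-basis writes every `z` as a combination of the `star (v j)` with right
  -- coefficients in the range of `F`.
  suffices hTv : ∀ j, T (constSeq A (star (v j))) = 0 by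
    refine sub_eq_zero.1 ((hT z).symm.trans ?_)
    rw [h.conj.eq_sum_seq z, map_sum]
    exact Finset.sum_eq_zero fun j _ => by rw [hTF, hTv, zero_mul]
  obtain ⟨H, hH⟩ := E.exists_gram_factorization v
  have hTvj (j : Fin n) : T (constSeq A (star (v j))) =
      ∑ k, (∑ i, T (constSeq A (u i)) * constSeq A (H i k)) * star (constSeq A (H j k : A)) := by
    rw [h.eq_sum_seq (constSeq A (star (v j))), map_sum]
    simp only [Finset.sum_mul]
    rw [Finset.sum_comm]
    refine Finset.sum_congr rfl fun i _ => ?_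
    rw [hTF, ← map_mul, seqExpectation_constSeq, hH]
    simp [mul_assoc, Finset.mul_sum, constSeq_star]
  have hstarT (z : SeqAlgebra A) : star (T z) = star z * e - F (star z * e) * (e * W) := by
    rw [hT, star_sub, star_mul, star_mul, star_mul, hes, hsw, star_seqExpectation, star_mul, hes]
  have hsum : ∑ j, T (constSeq A (star (v j))) * star (T (constSeq A (u j))) = 0 := by
    have q1 : ∑ j, constSeq A (star (v j)) * constSeq A (star (u j)) = W := by
      rw [← hsw, hWdef, hw]
      simp [star_sum, star_mul, constSeq_star]
    have q2 := (h.conj.eq_sum_seq e).symm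
    have q3 := (h.conj.eq_sum_seq' e).symm
    have q4 : ∑ j, F (e * constSeq A (star (v j))) * F (constSeq A (star (u j)) * e)
        = constSeq A w' := by
      simp only [← seqExpectation_left_mod, ← mul_assoc, F]
      rw [← map_sum, ← Finset.sum_mul, q3, hee, hE]
    -- Each of the four products equals `W * e`, with signs `+ - - +`.
    calc ∑ j, T (constSeq A (star (v j))) * star (T (constSeq A (u j)))
        = e * (∑ j, constSeq A (star (v j)) * constSeq A (star (u j))) * e
          - e * (∑ j, constSeq A (star (v j)) * F (constSeq A (star (u j)) * e)) * (e * W)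
          - W * e * (∑ j, F (e * constSeq A (star (v j))) * constSeq A (star (u j))) * e
          + W * e * (∑ j, F (e * constSeq A (star (v j))) * F (constSeq A (star (u j)) * e))
            * (e * W) := by
          simp only [Finset.mul_sum, Finset.sum_mul, ← Finset.sum_sub_distrib,
            ← Finset.sum_add_distrib]
          refine Finset.sum_congr rfl fun j _ => ?_
          rw [hstarT, hT, ← constSeq_star]
          noncomm_ring
      _ = 0 := by
          rw [q1, q2, q3, q4]
          have r1 : e * W * e = W * e := by rw [← hWz, mul_assoc, hee]
          have r2 : e * e * (e * W) = W * e := by rw [hee, ← mul_assoc, hee, hWz]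
          have r3 : W * e * e * e = W * e := by rw [mul_assoc W, hee, mul_assoc, hee]
          have r4 : W * e * constSeq A w' * (e * W) = W * e := by
            rw [mul_assoc W, hec, ← mul_assoc W, hWW', one_mul, ← mul_assoc, hee, hWz]
          rw [r1, r2, r3, r4]
          abel
  intro j
  rw [hTvj]
  refine Finset.sum_eq_zero fun k _ => ?_
  rw [SeqAlgebra.eq_zero_of_sum_mul_star_self_eq_zero
    (x := fun k => ∑ i, T (constSeq A (u i)) * constSeq A (H i k : A)) ?_ k, zero_mul]
  rw [← hsum]
  simp only [hTvj, star_sum, star_mul, Finset.mul_sum, Finset.sum_mul, ← mul_assoc]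
  rw [Finset.sum_comm]

end RohlinProjection

/-! ### The homomorphism from `A` to `P^∞`. -/

section RohlinHomomorphism

variable {A : Type*} [CStarAlgebra A] {P : StarSubalgebra ℂ A} [IsClosed (P : Set A)]

theorem mem_of_seqExpectation_eq_constSeq {E : ConditionalExpectation P} {e : SeqAlgebra A} {a : A}
    (h : seqExpectation E e = constSeq A a) : a ∈ P := by
  obtain ⟨ε, rfl⟩ := toSeq_surjective A e
  have h0 := mem_c0.1 (toSeq_eq_iff.1 ((seqExpectation_toSeq E ε).symm.trans h))
  refine (‹IsClosed (P : Set A)›).mem_of_tendsto (tendsto_iff_norm_sub_tendsto_zero.2 h0)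
    (Eventually.of_forall fun n => (E.toMap (ε n)).2)

/-- The sequence `n ↦ w * E(ε n * x)` representing `w * E^∞(e x)`, where `ε` represents `e`. -/
noncomputable def compressionSeq (E : ConditionalExpectation P) (w : A) (ε : ℕ →ᵇ A) (x : A) :
    ℕ →ᵇ A :=
  .const ℕ w * ((inclusionMap P).comp E.toMap).compLeftContinuousBounded ℕ (ε * .const ℕ x)

theorem compressionSeq_apply (E : ConditionalExpectation P) (w : A) (ε : ℕ →ᵇ A) (x : A) (n : ℕ) :
    compressionSeq E w ε x n = w * (E.toMap (ε n * x) : A) := rfl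

theorem norm_compressionSeq_apply_le (E : ConditionalExpectation P) (w : A) (ε : ℕ →ᵇ A) (x : A)
    (n : ℕ) : ‖compressionSeq E w ε x n‖ ≤ ‖w‖ * ‖ε‖ * ‖x‖ := by
  rw [compressionSeq_apply, mul_assoc]
  refine (norm_mul_le _ _).trans (mul_le_mul_of_nonneg_left ?_ (norm_nonneg _))
  refine (E.norm_le _).trans ((norm_mul_le _ _).trans ?_)
  exact mul_le_mul_of_nonneg_right (ε.norm_coe_le_norm n) (norm_nonneg _)

/-- The compression `x ↦ w E^∞(e x)` by a Rohlin projection `e`, with `w` the index. -/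
noncomputable def compression (E : ConditionalExpectation P) (w : A) (e : SeqAlgebra A) :
    A →ₗ[ℂ] SeqAlgebra A :=
  LinearMap.mulLeft ℂ (constSeq A w) ∘ₗ seqExpectation E ∘ₗ LinearMap.mulLeft ℂ e ∘ₗ
    (constSeq A).toAlgHom.toLinearMap

theorem compression_apply (E : ConditionalExpectation P) (w : A) (e : SeqAlgebra A) (x : A) :
    compression E w e x = constSeq A w * seqExpectation E (e * constSeq A x) := rfl

theorem toSeq_compressionSeq (E : ConditionalExpectation P) (w : A) (ε : ℕ →ᵇ A) (x : A) :
    toSeq A (compressionSeq E w ε x) = compression E w (toSeq A ε) x := rfl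

variable {E : ConditionalExpectation P} {n : ℕ} {u v : Fin n → A} {e : SeqAlgebra A} {w w' : A}

theorem compression_coe (hww' : w * w' = 1) (hE : seqExpectation E e = constSeq A w') (p : P) :
    compression E w e p = constSeq A p := by
  rw [compression_apply, ← seqExpectation_coe E p, seqExpectation_right_mod, ← mul_assoc, hE,
    ← map_mul, hww', map_one, one_mul]

theorem star_compression (h : IsQuasiBasis E u v) (he : e ∈ centralSeqAlgebra A)
    (hproj : IsStarProjection e) (hw : w = ∑ i, u i * v i) (x : A) :
    star (compression E w e x) = compression E w e (star x) := by
  have hws : IsSelfAdjoint w := hw ▸ h.isSelfAdjoint_sum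
  have hec : star (constSeq A x) * e = e * star (constSeq A x) :=
    ((StarSubalgebra.mem_centralizer_iff ℂ).1 he _ ⟨star x, rfl⟩).1
  rw [compression_apply, compression_apply, star_mul, star_seqExpectation, star_mul,
    hproj.isSelfAdjoint.star_eq, ← constSeq_star, ← constSeq_star, hws.star_eq, constSeq_star, hec,
    (commute_constSeq (fun a => hw ▸ h.commute_sum a) _).eq]

/-- Centrality of `e` and `e * x = e * β x` give `e * (x * y) = e * β x * β y`. Since `w` is in `P`,
both factors lie in the range of `E^∞` and can be pulled out of it, leaving `w * E^∞(e) = 1`. -/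
theorem compression_mul (h : IsQuasiBasis E u v) (he : e ∈ centralSeqAlgebra A)
    (hproj : IsStarProjection e) (hw : w = ∑ i, u i * v i) (hww' : w * w' = 1)
    (hE : seqExpectation E e = constSeq A w') (hwP : w ∈ P) (x y : A) :
    compression E w e (x * y) = compression E w e x * compression E w e y := by
  have hec (a : A) : e * constSeq A a = constSeq A a * e :=
    ((StarSubalgebra.mem_centralizer_iff ℂ).1 he _ ⟨a, rfl⟩).1.symm
  have hkey (x : A) : e * constSeq A x = e * compression E w e x := by
    rw [h.mul_eq_index_mul_mul_seqExpectation he hproj hw hww' hE, ← hec, mul_assoc]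
    rfl
  have hmem (x : A) : ∃ z, compression E w e x = seqExpectation E z := by
    refine ⟨constSeq A w * (e * constSeq A x), ?_⟩
    rw [compression_apply, ← seqExpectation_coe E ⟨w, hwP⟩, seqExpectation_left_mod]
  obtain ⟨a, ha⟩ := hmem x
  obtain ⟨b, hb⟩ := hmem y
  have hexy : e * constSeq A (x * y) = e * compression E w e x * compression E w e y := by
    rw [map_mul, ← mul_assoc, hec, mul_assoc, hkey, ← mul_assoc, ← hec, hkey]
  rw [compression_apply, hexy, hb, seqExpectation_right_mod, ha, seqExpectation_right_mod, hE,
    ← mul_assoc, ← mul_assoc, ← map_mul, hww', map_one, one_mul]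

end RohlinHomomorphism

/-! ### Descent of real rank zero. -/

section RealRankZero

theorem toSeq_eq_zero_iff {A : Type*} [CStarAlgebra A] {a : ℕ →ᵇ A} :
    toSeq A a = 0 ↔ Tendsto (fun n => ‖a n‖) atTop (𝓝 0) := by
  rw [← map_zero (toSeq A), toSeq_eq_iff, sub_zero, mem_c0]

theorem _root_.IsSelfAdjoint.isUnit_of_isUnit_mul {R : Type*} [Monoid R] [StarMul R] {s b : R}
    (hs : IsSelfAdjoint s) (h : IsUnit (s * b)) : IsUnit s := by
  have h' : IsUnit (star b * s) := by
    have := h.star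
    rwa [star_mul, hs.star_eq] at this
  obtain ⟨r, hr⟩ := h.exists_right_inv
  obtain ⟨l, hl⟩ := h'.exists_left_inv
  exact isUnit_iff_exists_and_exists.2 ⟨⟨b * r, by rw [← mul_assoc, hr]⟩,
    ⟨l * star b, by rw [mul_assoc, hl]⟩⟩

/-- Real rank zero passes to `P` from `A` if `A` is approximately mapped into `P` by bounded
sequences which are asymptotically multiplicative and involutive and fix `P`. -/
theorem RealRankZero.of_approximate_hom {A : Type*} [CStarAlgebra A] {P : StarSubalgebra ℂ A}
    [IsClosed (P : Set A)] (hA : RealRankZero A) (β : A →ₗ[ℂ] SeqAlgebra A) (b : A → ℕ →ᵇ A) (C : ℝ)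
    (hb : ∀ x, toSeq A (b x) = β x) (hbP : ∀ x n, b x n ∈ P) (hC : ∀ x n, ‖b x n‖ ≤ C * ‖x‖)
    (hmul : ∀ x y, β (x * y) = β x * β y) (hstar : ∀ x, star (β x) = β (star x))
    (hfix : ∀ p : P, β p = constSeq A p) : RealRankZero P := by
  rw [RealRankZero, Metric.dense_iff]
  intro p δ hδ
  have hC1 : 0 < |C| + 1 := by positivity
  obtain ⟨x, hxd, hxu⟩ := Metric.dense_iff.1 hA ⟨((p : P) : A), congrArg Subtype.val p.2⟩
    (δ / 2 / (|C| + 1)) (by positivity)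
  obtain ⟨y, hxy⟩ := hxu.exists_right_inv
  -- `b x` is self-adjoint only modulo null sequences; averaging makes each term exactly so without
  -- changing the class.
  let σ : ℕ →ᵇ A := (1 / 2 : ℂ) • (b x + star (b x))
  have hσ : toSeq A σ = β x := by
    rw [map_smul, map_add, ← star_toSeq, hb, hstar, x.2.star_eq, ← two_smul ℂ, smul_smul]
    norm_num
  have hσs (n : ℕ) : IsSelfAdjoint (σ n) := by
    change star ((1 / 2 : ℂ) • (b x n + star (b x n))) = (1 / 2 : ℂ) • (b x n + star (b x n))
    rw [star_smul, star_add, star_star, add_comm]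
    simp
  have hσP (n : ℕ) : σ n ∈ P :=
    P.smul_mem (add_mem (hbP _ n) (star_mem (hbP _ n))) _
  have h1 : Tendsto (fun n => ‖(σ * b y - 1) n‖) atTop (𝓝 0) := by
    rw [← toSeq_eq_zero_iff, map_sub, map_mul, hσ, hb, ← hmul, hxy, map_one (toSeq A), sub_eq_zero]
    exact (hfix 1).trans (map_one (constSeq A))
  have h2 : Tendsto (fun n => ‖(σ - .const ℕ ((p : P) : A) - b (x - ((p : P) : A))) n‖) atTop
      (𝓝 0) := by
    rw [← toSeq_eq_zero_iff, map_sub, map_sub, hσ, hb, map_sub, hfix]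
    exact sub_self _
  obtain ⟨n, hn1, hn2⟩ := ((h1.eventually_lt_const one_pos).and
    (h2.eventually_lt_const (half_pos hδ))).exists
  refine ⟨⟨⟨σ n, hσP n⟩, Subtype.ext (hσs n)⟩, ?_, ?_⟩
  · rw [Metric.mem_ball, Subtype.dist_eq, Subtype.dist_eq, dist_eq_norm]
    have hxp : ‖(x : A) - ((p : P) : A)‖ < δ / 2 / (|C| + 1) := by
      rwa [Metric.mem_ball, Subtype.dist_eq, dist_eq_norm] at hxd
    have h3 : ‖b (x - ((p : P) : A)) n‖ ≤ δ / 2 := by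
      refine (hC _ n).trans ?_
      calc C * ‖(x : A) - ((p : P) : A)‖ ≤ (|C| + 1) * (δ / 2 / (|C| + 1)) :=
            mul_le_mul ((le_abs_self C).trans (by linarith)) hxp.le (norm_nonneg _) hC1.le
        _ = δ / 2 := mul_div_cancel₀ _ hC1.ne'
    calc ‖σ n - ((p : P) : A)‖
        = ‖(σ n - ((p : P) : A) - b (x - ((p : P) : A)) n) + b (x - ((p : P) : A)) n‖ := by
          rw [sub_add_cancel]
      _ ≤ ‖σ n - ((p : P) : A) - b (x - ((p : P) : A)) n‖ + ‖b (x - ((p : P) : A)) n‖ :=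
          norm_add_le _ _
      _ < δ / 2 + δ / 2 := add_lt_add_of_lt_of_le hn2 h3
      _ = δ := add_halves δ
  -- Invertibility in `A` suffices, by spectral permanence; as `σ n` is self-adjoint, so does an
  -- approximate right inverse.
  · refine (StarSubalgebra.coe_isUnit (S := P)).1 ((hσs n).isUnit_of_isUnit_mul (b := b y n) ?_)
    have h4 : ‖1 - σ n * b y n‖ < 1 := by
      rw [norm_sub_rev]
      exact hn1
    simpa using isUnit_one_sub_of_norm_lt_one h4

end RealRankZero

end RohlinInclusion

theorem mainTheorem5 {A : Type*} [CStarAlgebra A] (P : StarSubalgebra ℂ A)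
    [IsClosed (P : Set A)] (hP : RohlinInclusion.InclusionHasRohlinProperty P)
    (hA : RohlinInclusion.RealRankZero A) : RohlinInclusion.RealRankZero P := by
  open RohlinInclusion in
  obtain ⟨E, ⟨n, u, v, h⟩, e, he, hproj, ⟨w, hw, hE⟩, -⟩ := hP
  replace hw : (w : A) = ∑ i, u i * v i := hw.trans (watataniIndex_eq h)
  replace hE : seqExpectation E e = constSeq A ((w⁻¹ : Aˣ) : A) := hE
  have hww' : (w : A) * ((w⁻¹ : Aˣ) : A) = 1 := w.mul_inv
  -- The inverse index is a norm limit of values of `E`, and `P` is closed; spectral permanence then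
  -- puts `w` itself in `P`.
  have hinv : ((w⁻¹ : Aˣ) : A) ∈ P := mem_of_seqExpectation_eq_constSeq hE
  have hwP : (w : A) ∈ P := by
    obtain ⟨q, hq⟩ := ((StarSubalgebra.coe_isUnit (S := P) (a := ⟨_, hinv⟩)).1
      (w⁻¹).isUnit).exists_right_inv
    have hq' : ((w⁻¹ : Aˣ) : A) * q = 1 := congrArg Subtype.val hq
    rw [show (w : A) = q by rw [← one_mul (q : A), ← hww', mul_assoc, hq', mul_one]]
    exact q.2
  obtain ⟨ε, rfl⟩ := toSeq_surjective A e
  refine hA.of_approximate_hom (compression E w (toSeq A ε)) (compressionSeq E w ε) (‖(w : A)‖ * ‖ε‖)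
    (toSeq_compressionSeq E w ε) (fun x k => mul_mem hwP (E.toMap _).2)
    (norm_compressionSeq_apply_le E w ε) (compression_mul h he hproj hw hww' hE hwP)
    (star_compression h he hproj hw) (compression_coe hww' hE)
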